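/- Let $n\ge 1$, let $I$ be the $n\times n$ identity matrix, and write $[B,C]=BCB^{-1}C^{-1}$ for $B,C\in GL_n(\mathbb C)$. Call $B\in GL_n(\mathbb C)$ an involution if $B^2=I$, a skew-involution if $B^2=-I$, of order $s$ if $B^s=I$, and of skew order $s$ if $B^s=-I$. For $s\ge 1$ let $UT_n^{(s)}(\mathbb C)$ (respectively $\pm UT_n^{(s)}(\mathbb C)$) be the set of upper triangular matrices in $GL_n(\mathbb C)$ all of whose diagonal entries $d$ satisfy $d^s=1$ (respectively $d^s\in\{1,-1\}$). Every $A\in SL_n(\mathbb C)$ can be written in each of the following four ways: 1. as a product of at most two commutators $[B,C]$, where $B$ and $C$ are involutions in $GL_n(\mathbb C)$, each similar to an element of $\pm UT_n^{(2)}(\mathbb C)$; 2. as a product of at most two commutators $[B,C]$, where $B\in GL_n(\mathbb C)$ is a skew-involution and $C\in GL_n(\mathbb C)$ is an involution, each similar to an element of $\pm UT_n^{(2)}(\mathbb C)$; 3. for every integer $k\ge 2$, as a product of at most $4k-6$ commutators $[B,C]$, where $B$ and $C$ are matrices of order $k$ in $GL_n(\mathbb C)$, each similar to an element of $UT_n^{(k)}(\mathbb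 C)$; 4. for every integer $k\ge 1$, as a product of at most $8k-6$ commutators $[B,C]$, where $B\in GL_n(\mathbb C)$ is of skew order $2k$ and $C\in GL_n(\mathbb C)$ is of order $2k$, each similar to an element of $\pm UT_n^{(2k)}(\mathbb C)$. Here "similar" means conjugate by an element of $GL_n(\mathbb C)$, separately for each matrix. -/

import Mathlib

namespace CommProd

/-- `GL_n(ℂ)`. -/
abbrev GLn (n : ℕ) : Type := Matrix.GeneralLinearGroup (Fin n) ℂ

/-- The group `UT_n^{(s)}(ℂ)` (as a set): invertible upper triangular matrices whose diagonal
entries are `s`-th roots of `1`. -/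
def UT (n s : ℕ) : Set (GLn n) :=
  {g | (∀ i j : Fin n, j < i → g.val i j = 0) ∧ ∀ i : Fin n, g.val i i ^ s = 1}

/-- The set `±UT_n^{(s)}(ℂ)`: invertible upper triangular matrices whose diagonal entries `d`
satisfy `d ^ s = 1` or `d ^ s = -1`. -/
def pmUT (n s : ℕ) : Set (GLn n) :=
  {g | (∀ i j : Fin n, j < i → g.val i j = 0) ∧
    ∀ i : Fin n, g.val i i ^ s = 1 ∨ g.val i i ^ s = -1}

/-- All matrices similar over `ℂ` to an element of `S`. -/
def similarTo {n : ℕ} (S : Set (GLn n)) : Set (GLn n) :=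
  {g | ∃ h ∈ S, IsConj h g}

/-- Matrices of finite order `k`, in the sense `A ^ k = I`. For `k = 2`: involutions. -/
def ofOrder (n k : ℕ) : Set (GLn n) := {g | g ^ k = 1}

/-- Matrices of skew finite order `k`, i.e. `A ^ k = -I`. For `k = 2`: skew-involutions. -/
def ofSkewOrder (n k : ℕ) : Set (GLn n) := {g | g ^ k = -1}

/-- The commutators `B * C * B⁻¹ * C⁻¹` with `B ∈ S` and `C ∈ T`. -/
def commutators {G : Type*} [Group G] (S T : Set G) : Set G :=
  {g | ∃ B ∈ S, ∃ C ∈ T, g = B * C * B⁻¹ * C⁻¹}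

/-- `g` is a product of at most `N` elements of `S`. -/
def IsProdOfAtMost {G : Type*} [Group G] (S : Set G) (N : ℕ) (g : G) : Prop :=
  ∃ l : List G, l.length ≤ N ∧ (∀ x ∈ l, x ∈ S) ∧ g = l.prod

end CommProd

/-!
Two commutators always suffice, so the bounds `4 * k - 6` and `8 * k - 6` are only used in the form
`2 ≤ _`. All four parts are instances of one fact: for complex numbers `a ≠ b` and `c ≠ d`, all
nonzero, every `A ∈ SL_n(ℂ)` is a product of two commutators `[B, C]` in which `B` is diagonalizable
with eigenvalues in `{a, b}` and `C` is diagonalizable with eigenvalues in `{c, d}`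
(`isProdOfAtMost_commutators`). The eigenvalues are `1, -1` for involutions, `1` and a primitive
`k`-th root of unity for matrices of order `k`, and `ζ, -ζ` with `ζ ^ (2 * k) = -1` for matrices of
skew order `2 * k`.

In size two, the trace of such a commutator can be any complex number, hence `diag(x, x⁻¹)` with
`x ≠ x⁻¹` is such a commutator (`hasComm_diagonal_pair`). Taking block sums, so is every diagonal
matrix whose entries form a multiset closed under inversion and avoiding `-1`
(`hasComm_diagonal_of_perm`), and being such a commutator is invariant under similarity.

It remains to write `A` as a product of two matrices similar to such diagonal matrices. If `A` is
not scalar, Sourour's theorem (`exists_mul_of_charpoly`) writes `A` as a product of two matrices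
with prescribed eigenvalues; these are chosen distinct, positive and closed under inversion, which
makes the factors diagonalizable. If `A` is a scalar `z` with `z ^ n = 1`, explicit diagonal factors
are used, built from powers of `z` (`exists_mul_hasComm_scalar`).
-/

namespace CommProd

open Matrix Polynomial

/-! ### Similarity of matrices -/

section Similarity

variable {K : Type*} [Field K] {ι κ : Type*} [Fintype ι] [DecidableEq ι] [Fintype κ]
  [DecidableEq κ]

/-- Similarity of square matrices, with the conjugating matrix and its inverse given as two
matrices `P`, `P'` satisfying `P * P' = 1`. -/
def Sim (A M : Matrix ι ι K) : Prop :=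
  ∃ P P' : Matrix ι ι K, P * P' = 1 ∧ A = P * M * P'

lemma Sim.refl (A : Matrix ι ι K) : Sim A A := ⟨1, 1, by simp, by simp⟩

lemma Sim.trans {A B C : Matrix ι ι K} (h₁ : Sim A B) (h₂ : Sim B C) : Sim A C := by
  obtain ⟨P, P', hP, rfl⟩ := h₁
  obtain ⟨Q, Q', hQ, rfl⟩ := h₂
  refine ⟨P * Q, Q' * P', ?_, by simp only [mul_assoc]⟩
  rw [mul_assoc, ← mul_assoc Q, hQ, one_mul, hP]

lemma Sim.symm {A B : Matrix ι ι K} (h : Sim A B) : Sim B A := by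
  obtain ⟨P, P', hP, rfl⟩ := h
  have hP' : P' * P = 1 := mul_eq_one_comm.mp hP
  refine ⟨P', P, hP', ?_⟩
  simp only [← mul_assoc, hP', one_mul]
  rw [mul_assoc, hP', mul_one]

lemma Sim.det_eq {A B : Matrix ι ι K} (h : Sim A B) : A.det = B.det := by
  obtain ⟨P, P', hP, rfl⟩ := h
  have : P.det * P'.det = 1 := by rw [← det_mul, hP, det_one]
  rw [det_mul, det_mul]
  linear_combination B.det * this

lemma Sim.charpoly_eq {A B : Matrix ι ι K} (h : Sim A B) : A.charpoly = B.charpoly := by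
  obtain ⟨P, P', hP, rfl⟩ := h
  rw [charpoly_mul_comm, ← mul_assoc, mul_eq_one_comm.mp hP, one_mul]

lemma Sim.reindex (e : ι ≃ κ) {A B : Matrix ι ι K} (h : Sim A B) :
    Sim (Matrix.reindex e e A) (Matrix.reindex e e B) := by
  obtain ⟨P, P', hP, rfl⟩ := h
  refine ⟨Matrix.reindex e e P, Matrix.reindex e e P', ?_, ?_⟩
  · simp [hP]
  · simp [Matrix.submatrix_mul_equiv]

lemma Sim.fromBlocks {A B : Matrix ι ι K} {C D : Matrix κ κ K} (h₁ : Sim A B) (h₂ : Sim C D) :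
    Sim (Matrix.fromBlocks A 0 0 C) (Matrix.fromBlocks B 0 0 D) := by
  obtain ⟨P, P', hP, rfl⟩ := h₁
  obtain ⟨Q, Q', hQ, rfl⟩ := h₂
  exact ⟨Matrix.fromBlocks P 0 0 Q, Matrix.fromBlocks P' 0 0 Q',
    by simp [fromBlocks_multiply, hP, hQ], by simp [fromBlocks_multiply]⟩

lemma sim_submatrix (σ : Equiv.Perm ι) (A : Matrix ι ι K) : Sim A (A.submatrix σ σ) := by
  refine ⟨(1 : Matrix ι ι K).submatrix id σ, (1 : Matrix ι ι K).submatrix σ id, ?_, ?_⟩ <;>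
  simp [Matrix.submatrix_mul_equiv]

/-- A matrix whose characteristic polynomial has the distinct roots `β i` is similar to the
diagonal matrix of the `β i`. -/
lemma sim_diagonal_of_charpoly {M : Matrix ι ι K} {β : ι → K} (hβ : Function.Injective β)
    (hM : M.charpoly = ∏ i, (X - C (β i))) : Sim M (diagonal β) := by
  have hv : ∀ i, ∃ v : ι → K, v ≠ 0 ∧ M *ᵥ v = β i • v := by
    intro i
    have h0 : (Matrix.scalar ι (β i) - M).det = 0 := by
      rw [← eval_charpoly, hM, eval_prod]
      exact Finset.prod_eq_zero (Finset.mem_univ i) (by simp)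
    obtain ⟨v, hv, h⟩ := exists_mulVec_eq_zero_iff.mpr h0
    refine ⟨v, hv, ?_⟩
    rw [sub_mulVec, sub_eq_zero] at h
    rw [← h]
    ext j
    simp [mulVec_diagonal]
  choose v hv0 hv using hv
  let P : Matrix ι ι K := Matrix.of fun i j => v j i
  have hli : LinearIndependent K P.col := by
    refine Module.End.eigenvectors_linearIndependent' (Matrix.toLin' M) β hβ v fun i => ?_
    exact ⟨Module.End.mem_eigenspace_iff.mpr (by simpa using hv i), hv0 i⟩
  have hP : IsUnit P.det := (isUnit_iff_isUnit_det _).mp (linearIndependent_cols_iff_isUnit.mp hli)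
  refine ⟨P, P⁻¹, mul_nonsing_inv _ hP, ?_⟩
  have hMP : M * P = P * diagonal β := by
    ext i j
    have := congrFun (hv j) i
    rw [mul_diagonal]
    simpa [P, Matrix.mul_apply, mulVec, dotProduct, mul_comm] using this
  rw [← hMP, mul_assoc, mul_nonsing_inv _ hP, mul_one]

end Similarity

/-! ### Factorization with prescribed eigenvalues -/

section Factorization

variable {K : Type*} [Field K]

/-- A non-scalar matrix moves some line, so in a suitable basis it moves the line of the `i₀`-th
basis vector. -/
lemma exists_sim_apply_ne_zero {ι : Type*} [Fintype ι] [DecidableEq ι] (i₀ : ι)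
    {A : Matrix ι ι K} (hA : ∀ c, A ≠ Matrix.scalar ι c) :
    ∃ M, Sim A M ∧ ∃ i, i ≠ i₀ ∧ M i i₀ ≠ 0 := by
  by_contra! H
  have hoff : ∀ i j, i ≠ j → A i j = 0 := by
    intro i j hij
    have := H _ (sim_submatrix (Equiv.swap i₀ j) A) (Equiv.swap i₀ j i)
      (by rw [Ne, Equiv.swap_apply_eq_iff, Equiv.swap_apply_left]; exact hij)
    simpa using this
  have hdiag : ∀ i, A i i = A i₀ i₀ := by
    intro i
    by_cases hi : i = i₀
    · rw [hi]
    have := H (transvection i i₀ (-1) * A * transvection i i₀ 1)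
      ⟨transvection i i₀ 1, transvection i i₀ (-1),
        by rw [transvection_mul_transvection_same _ _ hi]; simp, by
        simp only [← mul_assoc, transvection_mul_transvection_same _ _ hi]
        rw [mul_assoc, transvection_mul_transvection_same _ _ hi]; simp⟩ i hi
    simp [hoff i i₀ hi, hoff i₀ i (Ne.symm hi)] at this
    linear_combination this
  refine hA (A i₀ i₀) ?_
  ext i j
  by_cases hij : i = j
  · subst hij; simp [hdiag]
  · simp [hij, hoff i j hij]

variable {m : Type*} [Fintype m] [DecidableEq m]

/-- Conjugation by the shear with first row `(1, ε)`. -/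
lemma sim_shear (a : Matrix Unit Unit K) (y : Matrix Unit m K) (x : Matrix m Unit K)
    (D : Matrix m m K) (ε : Matrix Unit m K) :
    Sim (fromBlocks a y x D)
      (fromBlocks (a + ε * x) (y + ε * D - (a + ε * x) * ε) x (D - x * ε)) := by
  refine Sim.symm ⟨fromBlocks 1 ε 0 1, fromBlocks 1 (-ε) 0 1, ?_, ?_⟩
  · simp [fromBlocks_multiply]
  · simp only [fromBlocks_multiply, Matrix.one_mul, Matrix.mul_one, Matrix.zero_mul,
      Matrix.mul_zero, zero_add, add_zero, Matrix.mul_neg]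
    congr 1 <;> abel

lemma det_fromBlocks_smul_one {δ : K} (hδ : δ ≠ 0) (y : Matrix Unit m K) (x : Matrix m Unit K)
    (D : Matrix m m K) :
    (fromBlocks (δ • (1 : Matrix Unit Unit K)) y x D).det = δ * (D - δ⁻¹ • (x * y)).det := by
  have h : fromBlocks (δ • (1 : Matrix Unit Unit K)) y x D =
      fromBlocks (δ • (1 : Matrix Unit Unit K)) 0 x 1 *
        fromBlocks 1 (δ⁻¹ • y) 0 (D - δ⁻¹ • (x * y)) := by
    simp [fromBlocks_multiply, smul_smul, hδ]
  rw [h, det_mul, det_fromBlocks_zero₁₂, det_fromBlocks_zero₂₁]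
  simp

/-- A non-scalar invertible matrix is similar to one with prescribed nonzero corner entry `δ` and
with a non-scalar Schur complement of that corner, if there is room for one. -/
lemma exists_sim_fromBlocks {A : Matrix (Unit ⊕ m) (Unit ⊕ m) K}
    (hA : ∀ c, A ≠ Matrix.scalar _ c) (hdet : A.det ≠ 0) {δ : K} (hδ : δ ≠ 0) :
    ∃ (y : Matrix Unit m K) (x : Matrix m Unit K) (D : Matrix m m K),
      Sim A (fromBlocks (δ • 1) y x D) ∧
        (Subsingleton m ∨ ∀ c, D - δ⁻¹ • (x * y) ≠ Matrix.scalar m c) := by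
  obtain ⟨M, hAM, i, hi, hMi⟩ := exists_sim_apply_ne_zero (Sum.inl ()) hA
  obtain ⟨j, rfl⟩ : ∃ j, i = Sum.inr j := by
    rcases i with i | j
    · exact absurd rfl hi
    · exact ⟨j, rfl⟩
  obtain ⟨x, hx⟩ : ∃ x, x = M.toBlocks₂₁ := ⟨_, rfl⟩
  have hxj : x j () ≠ 0 := by rw [hx]; exact hMi
  -- A shear that puts `δ` into the corner.
  obtain ⟨y, D, hM⟩ : ∃ y D, Sim A (fromBlocks (δ • 1) y x D) := by
    let ε : Matrix Unit m K :=
      Matrix.of fun _ k => if k = j then (δ - M (Sum.inl ()) (Sum.inl ())) / x j () else 0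
    have hε : M.toBlocks₁₁ + ε * x = δ • 1 := by
      ext
      simp [ε, Matrix.mul_apply, toBlocks₁₁, hxj]
    have := sim_shear M.toBlocks₁₁ M.toBlocks₁₂ x M.toBlocks₂₂ ε
    rw [hε, hx, fromBlocks_toBlocks] at this
    exact ⟨_, _, hx ▸ hAM.trans this⟩
  by_cases hS : Subsingleton m ∨ ∀ c, D - δ⁻¹ • (x * y) ≠ Matrix.scalar m c
  · exact ⟨y, x, D, hM, hS⟩
  push Not at hS
  obtain ⟨hm, c, hc⟩ := hS
  have hc0 : c ≠ 0 := by
    rintro rfl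
    rw [hM.det_eq, det_fromBlocks_smul_one hδ, hc] at hdet
    have : Nonempty m := ⟨j⟩
    simp [det_zero] at hdet
  -- The Schur complement is scalar: a shear by `ε ≠ 0` with `ε * x = 0` keeps the corner and
  -- changes the complement by a nonzero multiple of the nilpotent matrix `x * ε`.
  obtain ⟨k, hk⟩ := exists_ne j
  let ε : Matrix Unit m K :=
    Matrix.of fun _ l => if l = k then x j () else if l = j then - x k () else 0
  have hεx : ε * x = 0 := by
    ext
    rw [Matrix.mul_apply, Finset.sum_eq_add k j hk]
    · simp [ε, hk.symm]; ring
    · intro l _ hl; simp [ε, hl.1, hl.2]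
    · simp
    · simp
  have hM' := hM.trans (sim_shear _ _ _ _ ε)
  rw [hεx, add_zero] at hM'
  refine ⟨_, _, _, hM', Or.inr fun c' hc' => ?_⟩
  have hD : D = Matrix.scalar m c + δ⁻¹ • (x * y) := by rw [← hc]; abel
  have hεD : ε * D = c • ε := by
    rw [hD, Matrix.mul_add, Matrix.mul_smul, ← Matrix.mul_assoc, hεx, Matrix.zero_mul, smul_zero, add_zero]
    ext a b
    simp [mul_comm]
  have key : Matrix.scalar m c - (δ⁻¹ * c) • (x * ε) = Matrix.scalar m c' := by
    rw [← hc', ← hc, hεD]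
    simp only [Matrix.smul_mul, Matrix.one_mul, Matrix.mul_sub, Matrix.mul_add, Matrix.mul_smul,
      smul_sub, smul_add, smul_smul, inv_mul_cancel₀ hδ, one_smul]
    abel
  have hoff := congrFun (congrFun key j) k
  have hne : δ⁻¹ * c * (x j () * x j ()) ≠ 0 :=
    mul_ne_zero (mul_ne_zero (inv_ne_zero hδ) hc0) (mul_ne_zero hxj hxj)
  apply hne
  simpa [Matrix.mul_apply, ε, hk.symm] using hoff

/-- **Sourour's theorem**, in terms of characteristic polynomials: a non-scalar invertible matrix
is a product of two matrices with prescribed nonzero eigenvalues, subject only to the determinant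
condition. In size at most one every matrix is scalar and the statement is trivial. -/
theorem exists_mul_of_charpoly (n : ℕ) :
    ∀ (A : Matrix (Fin n) (Fin n) K), (n ≤ 1 ∨ ∀ c, A ≠ Matrix.scalar _ c) →
      ∀ β γ : Fin n → K, (∀ i, β i ≠ 0) → (∀ i, γ i ≠ 0) → A.det = (∏ i, β i) * ∏ i, γ i →
        ∃ L U, A = L * U ∧ L.charpoly = ∏ i, (X - C (β i)) ∧ U.charpoly = ∏ i, (X - C (γ i)) := by
  induction n with
  | zero =>
    intro A _ β γ _ _ _
    exact ⟨A, 1, by simp, by simp [Matrix.charpoly], by simp [Matrix.charpoly]⟩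
  | succ n ih =>
    intro A hA β γ hβ hγ hdet
    rcases Nat.eq_zero_or_pos n with rfl | hn
    · refine ⟨diagonal β, diagonal γ, ?_, charpoly_diagonal _, charpoly_diagonal _⟩
      ext i j
      fin_cases i; fin_cases j
      simpa using hdet
    have hA : ∀ c, A ≠ Matrix.scalar _ c := hA.resolve_left (by omega)
    let e : Fin (n + 1) ≃ Unit ⊕ Fin n :=
      (finSuccEquiv n).trans ((Equiv.optionEquivSumPUnit _).trans (Equiv.sumComm _ _))
    have hA' : ∀ c, Matrix.reindex e e A ≠ Matrix.scalar _ c := by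
      intro c hc
      apply hA c
      apply (Matrix.reindex e e).injective
      rw [hc]
      ext i j
      simp [Matrix.diagonal_apply]
    have hprod : A.det ≠ 0 := by
      rw [hdet]
      exact mul_ne_zero (Finset.prod_ne_zero_iff.mpr fun i _ => hβ i)
        (Finset.prod_ne_zero_iff.mpr fun i _ => hγ i)
    have hδ : β 0 * γ 0 ≠ 0 := mul_ne_zero (hβ 0) (hγ 0)
    obtain ⟨y, x, D, hsim, hS⟩ :=
      exists_sim_fromBlocks hA' (by rwa [det_reindex_self]) hδ
    have hdetS := hsim.det_eq
    rw [det_reindex_self, det_fromBlocks_smul_one hδ, hdet, Fin.prod_univ_succ,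
      Fin.prod_univ_succ] at hdetS
    obtain ⟨L, U, hLU, hL, hU⟩ := ih (D - (β 0 * γ 0)⁻¹ • (x * y))
      (hS.imp_left fun h => by simpa using Fintype.card_le_one_iff_subsingleton.mpr h)
      (fun i => β i.succ) (fun i => γ i.succ) (fun i => hβ _) (fun i => hγ _)
      (mul_left_cancel₀ hδ (by rw [← hdetS]; ring))
    have hmul : fromBlocks ((β 0 * γ 0) • 1) y x D =
        fromBlocks (β 0 • (1 : Matrix Unit Unit K)) 0 ((γ 0)⁻¹ • x) L *
          fromBlocks (γ 0 • (1 : Matrix Unit Unit K)) ((β 0)⁻¹ • y) 0 U := by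
      simp [fromBlocks_multiply, smul_smul, hβ, hγ, ← hLU, mul_comm]
    obtain ⟨P, P', hP, hPA⟩ := hsim
    have hP' : P' * P = 1 := mul_eq_one_comm.mp hP
    have hunit : ∀ b : K, (b • (1 : Matrix Unit Unit K)).charpoly = X - C b := by
      intro b
      simp [Matrix.charpoly, Matrix.det_unique, charmatrix]
    have hconj : ∀ Y : Matrix (Unit ⊕ Fin n) (Unit ⊕ Fin n) K,
        (Matrix.reindex e.symm e.symm (P * Y * P')).charpoly = Y.charpoly := fun Y =>
      (charpoly_reindex e.symm _).trans (Sim.charpoly_eq ⟨P, P', hP, rfl⟩)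
    refine ⟨Matrix.reindex e.symm e.symm (P * fromBlocks (β 0 • 1) 0 ((γ 0)⁻¹ • x) L * P'),
      Matrix.reindex e.symm e.symm (P * fromBlocks (γ 0 • 1) ((β 0)⁻¹ • y) 0 U * P'),
      ?_, (hconj _).trans ?_, (hconj _).trans ?_⟩
    · apply (Matrix.reindex e e).injective
      rw [hPA, hmul]
      simp only [reindex_apply, Equiv.symm_symm, submatrix_mul_equiv, submatrix_submatrix,
        Equiv.self_comp_symm, submatrix_id_id]
      rw [show ∀ Y Z : Matrix (Unit ⊕ Fin n) (Unit ⊕ Fin n) K,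
        P * Y * P' * (P * Z * P') = P * Y * (P' * P) * Z * P' by
          intros; simp only [mul_assoc], hP']
      simp only [mul_assoc, one_mul]
    · rw [charpoly_fromBlocks_zero₁₂, hL, hunit, Fin.prod_univ_succ]
    · rw [charpoly_fromBlocks_zero₂₁, hU, hunit, Fin.prod_univ_succ]

end Factorization
/-! ### Commutators of diagonalizable matrices -/

section Commutator

variable {ι κ : Type*} [Fintype ι] [DecidableEq ι] [Fintype κ] [DecidableEq κ] {S T : Set ℂ}

/-- `B` is diagonalizable with all eigenvalues in `S`. -/
def DiagWith (S : Set ℂ) (B : Matrix ι ι ℂ) : Prop :=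
  ∃ d : ι → ℂ, (∀ i, d i ∈ S) ∧ Sim B (diagonal d)

/-- `X` is a commutator of diagonalizable matrices with eigenvalues in `S` and `T` respectively.
The equation `X = B * C * B⁻¹ * C⁻¹` is written without inverses; the two agree as soon as
`0 ∉ S` and `0 ∉ T`. -/
def HasComm (S T : Set ℂ) (X : Matrix ι ι ℂ) : Prop :=
  ∃ B C, DiagWith S B ∧ DiagWith T C ∧ B * C = X * (C * B)

lemma HasComm.of_sim {X Y : Matrix ι ι ℂ} (hY : HasComm S T Y) (h : Sim X Y) :
    HasComm S T X := by
  obtain ⟨B, C, ⟨d, hd, hB⟩, ⟨e, he, hC⟩, hBC⟩ := hY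
  obtain ⟨P, P', hP, rfl⟩ := h
  have hP' : P' * P = 1 := mul_eq_one_comm.mp hP
  have hmul : ∀ Y Z : Matrix ι ι ℂ, P * Y * P' * (P * Z * P') = P * (Y * Z) * P' := by
    intro Y Z
    rw [show P * Y * P' * (P * Z * P') = P * Y * (P' * P) * Z * P' by simp only [mul_assoc], hP']
    simp only [mul_assoc, one_mul]
  refine ⟨P * B * P', P * C * P', ⟨d, hd, .trans ⟨P, P', hP, rfl⟩ hB⟩,
    ⟨e, he, .trans ⟨P, P', hP, rfl⟩ hC⟩, ?_⟩
  rw [hmul, hmul, hmul, hBC]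

lemma DiagWith.reindex (e : ι ≃ κ) {B : Matrix ι ι ℂ} (h : DiagWith S B) :
    DiagWith S (Matrix.reindex e e B) := by
  obtain ⟨d, hd, hB⟩ := h
  refine ⟨d ∘ e.symm, fun i => hd _, ?_⟩
  have := hB.reindex e
  rwa [reindex_apply e e (diagonal d), submatrix_diagonal_equiv] at this

lemma HasComm.reindex (e : ι ≃ κ) {X : Matrix ι ι ℂ} (h : HasComm S T X) :
    HasComm S T (Matrix.reindex e e X) := by
  obtain ⟨B, C, hB, hC, hBC⟩ := h
  refine ⟨_, _, hB.reindex e, hC.reindex e, ?_⟩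
  simp [submatrix_mul_equiv, hBC]

lemma DiagWith.fromBlocks {B : Matrix ι ι ℂ} {C : Matrix κ κ ℂ} (hB : DiagWith S B)
    (hC : DiagWith S C) : DiagWith S (Matrix.fromBlocks B 0 0 C) := by
  obtain ⟨d, hd, hB⟩ := hB
  obtain ⟨e, he, hC⟩ := hC
  refine ⟨Sum.elim d e, by rintro (i | i) <;> simp [hd, he], ?_⟩
  rw [← fromBlocks_diagonal]
  exact hB.fromBlocks hC

lemma HasComm.fromBlocks {X : Matrix ι ι ℂ} {Y : Matrix κ κ ℂ} (hX : HasComm S T X)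
    (hY : HasComm S T Y) : HasComm S T (Matrix.fromBlocks X 0 0 Y) := by
  obtain ⟨B, C, hB, hC, h⟩ := hX
  obtain ⟨B', C', hB', hC', h'⟩ := hY
  exact ⟨_, _, hB.fromBlocks hB', hC.fromBlocks hC', by simp [fromBlocks_multiply, h, h']⟩

lemma hasComm_one {a c : ℂ} (ha : a ∈ S) (hc : c ∈ T) : HasComm S T (1 : Matrix ι ι ℂ) :=
  ⟨diagonal fun _ => a, diagonal fun _ => c, ⟨_, fun _ => ha, .refl _⟩, ⟨_, fun _ => hc, .refl _⟩,
    by simp [mul_comm]⟩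

lemma sim_diagonal_fin_two {M : Matrix (Fin 2) (Fin 2) ℂ} {x y : ℂ} (hxy : x ≠ y)
    (htr : M.trace = x + y) (hdet : M.det = x * y) : Sim M (diagonal ![x, y]) := by
  refine sim_diagonal_of_charpoly ?_ ?_
  · intro i j h
    fin_cases i <;> fin_cases j <;> simp_all
  · rw [charpoly_fin_two, htr, hdet, Fin.prod_univ_two]
    simp only [cons_val_zero, cons_val_one, map_add, map_mul]
    ring

/-- Fix two distinct nonzero eigenvalues `a, b` of `B` and `c, d` of `C`, both of size two. The
trace of the commutator is a nonconstant affine function of the product of the off-diagonal entries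
of `C` in an eigenbasis of `B`, so it takes every value, and the trace determines the conjugacy
class of a matrix of determinant one with distinct eigenvalues. -/
lemma hasComm_diagonal_pair {a b c d x : ℂ} (ha : a ≠ 0) (hb : b ≠ 0) (hc : c ≠ 0) (hd : d ≠ 0)
    (hab : a ≠ b) (hcd : c ≠ d) (hx0 : x ≠ 0) (hx : x ≠ x⁻¹) :
    HasComm {a, b} {c, d} (diagonal ![x, x⁻¹]) := by
  have hab' : a - b ≠ 0 := sub_ne_zero.mpr hab
  -- The off-diagonal product for which the commutator has trace `x + x⁻¹`.
  obtain ⟨t, ht⟩ : ∃ t, t = -(a * b * c * d * (x - 1) ^ 2) / (x * (a - b) ^ 2) := ⟨_, rfl⟩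
  -- `p` and `s` solve `p + s = c + d` and `p * s = c * d + t`.
  obtain ⟨r, hr⟩ := IsAlgClosed.exists_pow_nat_eq ((c - d) ^ 2 - 4 * t) (n := 2) two_pos
  obtain ⟨p, hp⟩ : ∃ p, p = (c + d + r) / 2 := ⟨_, rfl⟩
  obtain ⟨s, hs⟩ : ∃ s, s = (c + d - r) / 2 := ⟨_, rfl⟩
  have hsum : p + s = c + d := by rw [hp, hs]; ring
  have hprod : p * s - t = c * d := by rw [hp, hs]; linear_combination (-1 / 4 : ℂ) * hr
  let B : Matrix (Fin 2) (Fin 2) ℂ := diagonal ![a, b]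
  let C : Matrix (Fin 2) (Fin 2) ℂ := !![p, 1; t, s]
  have hC : Sim C (diagonal ![c, d]) :=
    sim_diagonal_fin_two hcd (by simpa [C, trace_fin_two] using hsum)
      (by simpa [C, det_fin_two] using hprod)
  let B' : Matrix (Fin 2) (Fin 2) ℂ := diagonal ![a⁻¹, b⁻¹]
  let C' : Matrix (Fin 2) (Fin 2) ℂ := (c * d)⁻¹ • !![s, -1; -t, p]
  have hBB : B' * B = 1 := by
    ext i j
    fin_cases i <;> fin_cases j <;> simp [B, B', ha, hb]
  have hcd0 : c * d ≠ 0 := mul_ne_zero hc hd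
  have hCC : C' * C = 1 := by
    have h : s * p - t = c * d := by rw [← hprod]; ring
    ext i j
    fin_cases i <;> fin_cases j <;> simp [C, C', Matrix.mul_apply, Fin.sum_univ_two] <;>
      field_simp
    · linear_combination h
    · ring
    · linear_combination h
  have hmem : ∀ u v : ℂ, ∀ i, (![u, v] : Fin 2 → ℂ) i ∈ ({u, v} : Set ℂ) := by
    intro u v i
    fin_cases i <;> simp
  have hX : HasComm {a, b} {c, d} (B * C * (B' * C')) := by
    refine ⟨B, C, ⟨_, hmem a b, .refl _⟩, ⟨_, hmem c d, hC⟩, ?_⟩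
    rw [show B * C * (B' * C') * (C * B) = B * C * (B' * (C' * C) * B) by simp only [mul_assoc],
      hCC, mul_one, hBB, mul_one]
  refine hX.of_sim (Sim.symm (sim_diagonal_fin_two hx ?_ ?_))
  · have h : B * C * (B' * C') = (c * d)⁻¹ •
        !![p * s - t * a * b⁻¹, -p + p * a * b⁻¹; t * s * b * a⁻¹ - t * s, -t * b * a⁻¹ + s * p] := by
      ext i j
      fin_cases i <;> fin_cases j <;>
        simp [B, B', C, C', Matrix.mul_apply, Fin.sum_univ_two] <;> field_simp <;> ring
    rw [h, trace_smul, trace_fin_two_of, smul_eq_mul]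
    have h1 : p * s - t * a * b⁻¹ + (-t * b * a⁻¹ + s * p) =
        2 * (c * d) + t * (2 - a * b⁻¹ - b * a⁻¹) := by linear_combination 2 * hprod
    rw [h1, ht]
    field_simp
    ring
  · have h1 : B'.det * B.det = 1 := by rw [← det_mul, hBB, det_one]
    have h2 : C'.det * C.det = 1 := by rw [← det_mul, hCC, det_one]
    rw [det_mul, det_mul, det_mul, mul_inv_cancel₀ hx0]
    linear_combination C'.det * C.det * h1 + h2

end Commutator

/-! ### Diagonal matrices with spectrum closed under inversion -/

section Spectrum

/-- Families with the same multiset of values agree up to a bijection of the index types. -/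
lemma exists_equiv_of_map_univ_eq {ι κ α : Type*} [Fintype ι] [Fintype κ] [DecidableEq α]
    {x : ι → α} {y : κ → α} (h : Finset.univ.val.map x = Finset.univ.val.map y) :
    ∃ e : ι ≃ κ, ∀ i, y (e i) = x i := by
  have hfib : ∀ c, Nonempty ({i // x i = c} ≃ {j // y j = c}) := by
    intro c
    have hc := congrArg (Multiset.count c) h
    rw [Multiset.count_map, Multiset.count_map] at hc
    refine Fintype.card_eq.mp ?_
    rw [Fintype.card_subtype, Fintype.card_subtype]
    simpa [Finset.card_def, eq_comm] using hc
  exact ⟨Equiv.ofFiberEquiv fun c => (hfib c).some, fun i => Equiv.ofFiberEquiv_map _ i⟩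

/-- Some diagonal matrix whose diagonal entries form the multiset `s` satisfies `HasComm S T`;
the choice of the index type and of the order of the entries is immaterial. -/
def SpecHasComm (S T : Set ℂ) (s : Multiset ℂ) : Prop :=
  ∃ (ι : Type) (_ : Fintype ι) (_ : DecidableEq ι) (x : ι → ℂ),
    Finset.univ.val.map x = s ∧ HasComm S T (diagonal x)

variable {S T : Set ℂ}

lemma SpecHasComm.add {s t : Multiset ℂ} (hs : SpecHasComm S T s) (ht : SpecHasComm S T t) :
    SpecHasComm S T (s + t) := by
  obtain ⟨ι, _, _, x, rfl, hx⟩ := hs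
  obtain ⟨κ, _, _, y, rfl, hy⟩ := ht
  refine ⟨ι ⊕ κ, inferInstance, inferInstance, Sum.elim x y, ?_, ?_⟩
  · rw [← Finset.univ_disjSum_univ, Finset.val_disjSum, Multiset.disjSum]
    simp
  · rw [← fromBlocks_diagonal]
    exact hx.fromBlocks hy

lemma SpecHasComm.hasComm {ι : Type*} [Fintype ι] [DecidableEq ι] {x : ι → ℂ}
    (h : SpecHasComm S T (Finset.univ.val.map x)) : HasComm S T (diagonal x) := by
  obtain ⟨κ, _, _, y, hyx, hy⟩ := h
  obtain ⟨e, he⟩ := exists_equiv_of_map_univ_eq hyx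
  have := hy.reindex e
  rwa [reindex_apply, submatrix_diagonal_equiv,
    show y ∘ e.symm = x by ext i; simp [← he]] at this

variable {a b c d : ℂ}

/-- A multiset closed under inversion and avoiding `-1` splits into ones and pairs `{x, x⁻¹}` of
distinct numbers. -/
lemma specHasComm_of_map_inv (ha : a ≠ 0) (hb : b ≠ 0) (hc : c ≠ 0) (hd : d ≠ 0)
    (hab : a ≠ b) (hcd : c ≠ d) (s : Multiset ℂ) :
    0 ∉ s → -1 ∉ s → s.map (·⁻¹) = s → SpecHasComm {a, b} {c, d} s := by
  induction s using Multiset.strongInductionOn with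
  | ih s ih =>
  intro h0 h1 hs
  rcases Multiset.empty_or_exists_mem s with rfl | ⟨x, hx⟩
  · refine ⟨Fin 0, inferInstance, inferInstance, fun _ => 1, by simp, ?_⟩
    simpa using hasComm_one (ι := Fin 0) (S := {a, b}) (T := {c, d}) (Or.inl rfl) (Or.inl rfl)
  obtain ⟨t, rfl⟩ := Multiset.exists_cons_of_mem hx
  simp only [Multiset.mem_cons, not_or] at h0 h1
  by_cases hx1 : x = 1
  · subst hx1
    rw [← Multiset.singleton_add]
    refine SpecHasComm.add ⟨Unit, inferInstance, inferInstance, fun _ => 1, by simp, ?_⟩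
      (ih t (Multiset.lt_cons_self _ _) h0.2 h1.2 (by simpa using hs))
    simpa using hasComm_one (ι := Unit) (S := {a, b}) (T := {c, d}) (Or.inl rfl) (Or.inl rfl)
  have hx0 : x ≠ 0 := fun h => h0.1 h.symm
  have hxx : x ≠ x⁻¹ := by
    intro h
    have : (x - 1) * (x + 1) = 0 := by
      have := mul_inv_cancel₀ hx0
      rw [← h] at this
      linear_combination this
    rcases mul_eq_zero.mp this with h | h
    · exact hx1 (sub_eq_zero.mp h)
    · exact h1.1 (eq_neg_of_add_eq_zero_left h).symm
  have hmem : x⁻¹ ∈ t := by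
    have : x⁻¹ ∈ x ::ₘ t := by
      rw [← hs]
      exact Multiset.mem_map_of_mem _ (Multiset.mem_cons_self _ _)
    exact (Multiset.mem_cons.mp this).resolve_left (Ne.symm hxx)
  obtain ⟨u, rfl⟩ := Multiset.exists_cons_of_mem hmem
  simp only [Multiset.mem_cons, not_or] at h0 h1
  have hu : u.map (·⁻¹) = u := by
    rw [Multiset.map_cons, Multiset.map_cons, inv_inv, Multiset.cons_swap] at hs
    simpa using hs
  have := SpecHasComm.add
    ⟨Fin 2, inferInstance, inferInstance, ![x, x⁻¹], rfl,
      hasComm_diagonal_pair ha hb hc hd hab hcd hx0 hxx⟩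
    (ih u ((Multiset.lt_cons_self _ _).trans (Multiset.lt_cons_self _ _)) h0.2.2 h1.2.2 hu)
  convert this using 1
  simp [Fin.univ_succ]

lemma hasComm_diagonal_of_perm (ha : a ≠ 0) (hb : b ≠ 0) (hc : c ≠ 0) (hd : d ≠ 0)
    (hab : a ≠ b) (hcd : c ≠ d) {ι : Type*} [Fintype ι] [DecidableEq ι] (x : ι → ℂ)
    (σ : Equiv.Perm ι) (h0 : ∀ i, x i ≠ 0) (h1 : ∀ i, x i ≠ -1) (hσ : ∀ i, x (σ i) = (x i)⁻¹) :
    HasComm {a, b} {c, d} (diagonal x) := by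
  refine (specHasComm_of_map_inv ha hb hc hd hab hcd _ (by simpa using h0) (by simpa using h1)
    ?_).hasComm
  rw [Multiset.map_map]
  conv_rhs => rw [← Multiset.map_univ_val_equiv σ, Multiset.map_map]
  exact Multiset.map_congr rfl fun i _ => (hσ i).symm

end Spectrum

/-! ### Products of two commutators -/

section Products

variable {a b c d : ℂ}

lemma exists_mul_hasComm_of_not_scalar (ha : a ≠ 0) (hb : b ≠ 0) (hc : c ≠ 0) (hd : d ≠ 0)
    (hab : a ≠ b) (hcd : c ≠ d) {n : ℕ} {A : Matrix (Fin n) (Fin n) ℂ} (hdet : A.det = 1)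
    (hA : ∀ z, A ≠ Matrix.scalar _ z) :
    ∃ X Y, A = X * Y ∧ HasComm {a, b} {c, d} X ∧ HasComm {a, b} {c, d} Y := by
  -- Distinct positive eigenvalues `2 ^ (1 - n), 2 ^ (3 - n), …, 2 ^ (n - 1)`.
  let r : Fin n → ℝ := fun i => 2 ^ (2 * (i : ℤ) - ((n : ℤ) - 1))
  have hr : ∀ i, 0 < r i := fun i => by positivity
  have hrev : ∀ i, r i.rev = (r i)⁻¹ := by
    intro i
    simp only [r, ← _root_.zpow_neg]
    congr 1
    have := i.isLt
    rw [Fin.val_rev]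
    push_cast [show (i : ℕ) + 1 ≤ n by omega]
    ring
  have hinj : Function.Injective r := by
    intro i j h
    have := zpow_right_injective₀ (a := (2 : ℝ)) two_pos (by norm_num) h
    ext
    omega
  have hprod : ∏ i, r i = 1 := by
    have h1 : ∏ i, r i = (∏ i, r i)⁻¹ := by
      conv_lhs => rw [← Equiv.prod_comp Fin.revPerm]
      rw [← Finset.prod_inv_distrib]
      exact Finset.prod_congr rfl fun i _ => hrev i
    have h2 : 0 < ∏ i, r i := Finset.prod_pos fun i _ => hr i
    nlinarith [mul_inv_cancel₀ h2.ne']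
  have hne : ∀ i, (r i : ℂ) ≠ 0 := fun i => by exact_mod_cast (hr i).ne'
  have hinjC : Function.Injective fun i => (r i : ℂ) := Complex.ofReal_injective.comp hinj
  -- Both factors get this spectrum.
  have hdiag : HasComm {a, b} {c, d} (diagonal fun i => (r i : ℂ)) := by
    refine hasComm_diagonal_of_perm ha hb hc hd hab hcd _ Fin.revPerm hne (fun i => ?_) fun i => ?_
    · have : r i ≠ -1 := by linarith [hr i]
      exact_mod_cast this
    · rw [Fin.revPerm_apply, hrev, Complex.ofReal_inv]
  obtain ⟨L, U, hLU, hL, hU⟩ := exists_mul_of_charpoly n A (Or.inr hA) (fun i => (r i : ℂ))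
    (fun i => (r i : ℂ)) hne hne (by rw [hdet, ← Complex.ofReal_prod, hprod]; simp)
  exact ⟨L, U, hLU, hdiag.of_sim (sim_diagonal_of_charpoly hinjC hL),
    hdiag.of_sim (sim_diagonal_of_charpoly hinjC hU)⟩

/-- It suffices to factor the scalar `z` entrywise, over any index type of the right size. -/
lemma exists_mul_hasComm_scalar_of_diagonal {S T : Set ℂ} {n : ℕ} {z : ℂ} {ι : Type*} [Fintype ι]
    [DecidableEq ι] (hι : Fintype.card ι = n) (x y : ι → ℂ) (hxy : ∀ i, x i * y i = z)
    (hx : HasComm S T (diagonal x)) (hy : HasComm S T (diagonal y)) :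
    ∃ X Y, Matrix.scalar (Fin n) z = X * Y ∧ HasComm S T X ∧ HasComm S T Y := by
  let e : ι ≃ Fin n := Fintype.equivFinOfCardEq hι
  refine ⟨_, _, ?_, hx.reindex e, hy.reindex e⟩
  rw [reindex_apply, reindex_apply, submatrix_diagonal_equiv, submatrix_diagonal_equiv,
    diagonal_mul_diagonal]
  simp [hxy]

/-- A scalar `z` with `z ^ n = 1` is a product of two diagonal matrices whose spectra are closed
under inversion and avoid `-1`. For odd `n` both spectra consist of all powers of `z`; for even `n`
that list may contain `-1`, and the powers of `z ^ 2`, multiplied by `2` and by `2⁻¹`, are used for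
the first factor. -/
lemma exists_mul_hasComm_scalar (ha : a ≠ 0) (hb : b ≠ 0) (hc : c ≠ 0) (hd : d ≠ 0)
    (hab : a ≠ b) (hcd : c ≠ d) {n : ℕ} {z : ℂ} (hz : z ^ n = 1) :
    ∃ X Y, Matrix.scalar (Fin n) z = X * Y ∧ HasComm {a, b} {c, d} X ∧
      HasComm {a, b} {c, d} Y := by
  rcases Nat.eq_zero_or_pos n with rfl | hn
  · exact ⟨1, 1, by ext i; exact i.elim0, hasComm_one (Or.inl rfl) (Or.inl rfl),
      hasComm_one (Or.inl rfl) (Or.inl rfl)⟩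
  have hz0 : z ≠ 0 := by
    rintro rfl
    simp [hn.ne'] at hz
  rcases Nat.even_or_odd' n with ⟨m, rfl | rfl⟩
  · have : NeZero m := ⟨by omega⟩
    have hz2 : (z ^ 2) ^ m = 1 := by rw [← pow_mul, hz]
    -- The factor `2 ^ (±1)` keeps the entries off the unit circle, hence away from `-1`.
    let χ : AddChar (ZMod m) ℂ := AddChar.zmodChar m hz2
    let w : Bool → ℂ := fun s => if s then 2 else 2⁻¹
    have hw : ∀ s, w (!s) = (w s)⁻¹ := by rintro (_ | _) <;> simp [w]
    have hw0 : ∀ s, w s ≠ 0 := by rintro (_ | _) <;> simp [w]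
    have hχ : ∀ j, ‖χ j‖ = 1 := fun j => by
      rw [AddChar.zmodChar_apply, norm_pow, norm_pow,
        Complex.norm_eq_one_of_pow_eq_one hz hn.ne', one_pow, one_pow]
    have hχ0 : ∀ j, χ j ≠ 0 := fun j => norm_ne_zero_iff.mp (by rw [hχ]; exact one_ne_zero)
    have hχ1 : χ 1 = z ^ 2 := by simpa using AddChar.zmodChar_apply' hz2 1
    have hnorm : ∀ u : ℂ, ∀ s, ‖u‖ = 1 → u * w s ≠ -1 := by
      intro u s hu h
      have := congrArg norm h
      rw [norm_mul, hu, one_mul, norm_neg, norm_one] at this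
      cases s <;> norm_num [w] at this
    refine exists_mul_hasComm_scalar_of_diagonal (ι := ZMod m × Bool) (by simp [ZMod.card, mul_comm])
      (fun p => χ p.1 * w p.2) (fun p => z * χ (-p.1) * w (!p.2)) ?_ ?_ ?_
    · intro p
      rw [AddChar.map_neg_eq_inv, hw]
      field_simp [hχ0, hw0]
    · refine hasComm_diagonal_of_perm ha hb hc hd hab hcd _
        (Equiv.prodCongr (Equiv.neg _) Equiv.boolNot) (fun p => mul_ne_zero (hχ0 _) (hw0 _))
        (fun p => hnorm _ _ (hχ _)) fun p => ?_
      simp [AddChar.map_neg_eq_inv, hw, mul_comm]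
    · -- `(z * χ (-j))⁻¹ = z * χ (j - 1)`, because `χ 1 = z ^ 2`.
      refine hasComm_diagonal_of_perm ha hb hc hd hab hcd _
        (Equiv.prodCongr (Equiv.subLeft 1) Equiv.boolNot)
        (fun p => mul_ne_zero (mul_ne_zero hz0 (hχ0 _)) (hw0 _)) (fun p => hnorm _ _ ?_) fun p => ?_
      · rw [norm_mul, hχ, Complex.norm_eq_one_of_pow_eq_one hz hn.ne', one_mul]
      · simp only [Equiv.prodCongr_apply, Prod.map_fst, Prod.map_snd, Equiv.subLeft_apply,
          Equiv.boolNot_apply, neg_sub, AddChar.map_neg_eq_inv, AddChar.map_sub_eq_div, hχ1, hw]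
        field_simp [hχ0, hw0]
  · -- An odd power of `-1` is not `1`, so no `n`-th root of unity equals `-1`.
    let χ : AddChar (ZMod (2 * m + 1)) ℂ := AddChar.zmodChar _ hz
    have hχn : ∀ j, χ j ^ (2 * m + 1) = 1 := fun j => by
      rw [AddChar.zmodChar_apply, pow_right_comm, hz, one_pow]
    have hχ0 : ∀ j, χ j ≠ 0 := fun j h => by simpa [h] using hχn j
    have hχm : ∀ j, χ j ≠ -1 := fun j h => by
      have := hχn j
      rw [h, Odd.neg_one_pow ⟨m, rfl⟩] at this
      norm_num at this
    have hχ1 : χ 1 = z := by simpa using AddChar.zmodChar_apply' hz 1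
    refine exists_mul_hasComm_scalar_of_diagonal (ι := ZMod (2 * m + 1)) (ZMod.card _)
      (fun j => χ j) (fun j => χ (1 - j)) ?_ ?_ ?_
    · intro j
      rw [← AddChar.map_add_eq_mul, add_sub_cancel, hχ1]
    · exact hasComm_diagonal_of_perm ha hb hc hd hab hcd _ (Equiv.neg _) (fun _ => hχ0 _)
        (fun _ => hχm _) fun j => by simp [AddChar.map_neg_eq_inv]
    · refine hasComm_diagonal_of_perm ha hb hc hd hab hcd _ (Equiv.subLeft 2) (fun _ => hχ0 _)
        (fun _ => hχm _) fun j => ?_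
      rw [← AddChar.map_neg_eq_inv, Equiv.subLeft_apply]
      congr 1
      ring

lemma exists_mul_hasComm (ha : a ≠ 0) (hb : b ≠ 0) (hc : c ≠ 0) (hd : d ≠ 0)
    (hab : a ≠ b) (hcd : c ≠ d) {n : ℕ} {A : Matrix (Fin n) (Fin n) ℂ} (hdet : A.det = 1) :
    ∃ X Y, A = X * Y ∧ HasComm {a, b} {c, d} X ∧ HasComm {a, b} {c, d} Y := by
  by_cases hA : ∀ z, A ≠ Matrix.scalar _ z
  · exact exists_mul_hasComm_of_not_scalar ha hb hc hd hab hcd hdet hA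
  · push Not at hA
    obtain ⟨z, rfl⟩ := hA
    exact exists_mul_hasComm_scalar ha hb hc hd hab hcd (by simpa using hdet)

/-- A diagonalizable matrix with nonzero eigenvalues, as an element of the general linear group. -/
lemma DiagWith.exists_isConj {S : Set ℂ} (h0 : 0 ∉ S) {n : ℕ} {B : Matrix (Fin n) (Fin n) ℂ}
    (hB : DiagWith S B) : ∃ (g h : GLn n) (d : Fin n → ℂ), g.val = B ∧ IsConj h g ∧
      h.val = diagonal d ∧ ∀ i, d i ∈ S := by
  obtain ⟨d, hd, P, P', hP, rfl⟩ := hB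
  have hd0 : ∀ i, d i ≠ 0 := fun i h => h0 (h ▸ hd i)
  let u : GLn n := ⟨P, P', hP, mul_eq_one_comm.mp hP⟩
  let h : GLn n := ⟨diagonal d, diagonal fun i => (d i)⁻¹, by simp [hd0], by simp [hd0]⟩
  exact ⟨u * h * u⁻¹, h, d, rfl, isConj_iff.mpr ⟨u, rfl⟩, rfl, hd⟩

lemma pow_eq_of_isConj_diagonal {n k : ℕ} {g h : GLn n} {d : Fin n → ℂ} {z : GLn n} {w : ℂ}
    (hz : z.val = Matrix.scalar _ w) (hgh : IsConj h g) (hh : h.val = diagonal d)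
    (hd : ∀ i, d i ^ k = w) : g ^ k = z := by
  have hk : h ^ k = z := by
    ext1
    rw [Units.val_pow_eq_pow_val, hh, diagonal_pow, hz, show d ^ k = fun _ => w from funext hd]
    rfl
  obtain ⟨u, rfl⟩ := isConj_iff.mp hgh
  have hcomm : u * z = z * u := by
    ext1
    rw [Units.val_mul, Units.val_mul, hz]
    exact ((Matrix.scalar_commute w (fun _ => mul_comm _ _) u.val).eq).symm
  rw [conj_pow, hk, hcomm, mul_inv_cancel_right]

lemma DiagWith.exists_mem_ofOrder {S : Set ℂ} (h0 : 0 ∉ S) {n k : ℕ} (hS : ∀ s ∈ S, s ^ k = 1)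
    {B : Matrix (Fin n) (Fin n) ℂ} (hB : DiagWith S B) :
    ∃ g ∈ ofOrder n k ∩ similarTo (UT n k), g.val = B := by
  obtain ⟨g, h, d, rfl, hgh, hh, hd⟩ := hB.exists_isConj h0
  refine ⟨g, ⟨pow_eq_of_isConj_diagonal (w := 1) (by simp) hgh hh fun i => hS _ (hd i), h,
    ⟨fun i j hij => ?_, fun i => ?_⟩, hgh⟩, rfl⟩
  · rw [hh, diagonal_apply_ne _ hij.ne']
  · rw [hh, diagonal_apply_eq]
    exact hS _ (hd i)

lemma similarTo_mono {n : ℕ} {S T : Set (GLn n)} (h : S ⊆ T) : similarTo S ⊆ similarTo T :=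
  fun _ ⟨x, hx, hxg⟩ => ⟨x, h hx, hxg⟩

lemma UT_subset_pmUT (n k : ℕ) : UT n k ⊆ pmUT n k := fun _ hg => ⟨hg.1, fun i => Or.inl (hg.2 i)⟩

lemma DiagWith.exists_mem_ofSkewOrder {S : Set ℂ} (h0 : 0 ∉ S) {n k : ℕ}
    (hS : ∀ s ∈ S, s ^ k = -1) {B : Matrix (Fin n) (Fin n) ℂ} (hB : DiagWith S B) :
    ∃ g ∈ ofSkewOrder n k ∩ similarTo (pmUT n k), g.val = B := by
  obtain ⟨g, h, d, rfl, hgh, hh, hd⟩ := hB.exists_isConj h0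
  refine ⟨g, ⟨pow_eq_of_isConj_diagonal (w := -1) (by ext; simp [Matrix.one_apply, diagonal_apply, apply_ite]) hgh hh fun i => hS _ (hd i), h,
    ⟨fun i j hij => ?_, fun i => Or.inr ?_⟩, hgh⟩, rfl⟩
  · rw [hh, diagonal_apply_ne _ hij.ne']
  · rw [hh, diagonal_apply_eq]
    exact hS _ (hd i)

lemma HasComm.exists_mem_commutators {n : ℕ} {S T : Set ℂ} {S' T' : Set (GLn n)}
    (hS : ∀ B, DiagWith S B → ∃ g ∈ S', g.val = B) (hT : ∀ C, DiagWith T C → ∃ g ∈ T', g.val = C)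
    {X : Matrix (Fin n) (Fin n) ℂ} (hX : HasComm S T X) :
    ∃ g ∈ commutators S' T', g.val = X := by
  obtain ⟨B, C, hB, hC, h⟩ := hX
  obtain ⟨g, hg, rfl⟩ := hS B hB
  obtain ⟨g', hg', rfl⟩ := hT C hC
  refine ⟨_, ⟨g, hg, g', hg', rfl⟩, ?_⟩
  rw [mul_assoc (g * g'), ← _root_.mul_inv_rev, Units.val_mul, Units.val_mul, h, mul_assoc,
    ← Units.val_mul, ← Units.val_mul, mul_inv_cancel, Units.val_one, mul_one]

/-- The common form of the four parts: `S'` and `T'` only need to contain all diagonalizable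
matrices with eigenvalues `a, b`, respectively `c, d`. -/
lemma isProdOfAtMost_commutators (ha : a ≠ 0) (hb : b ≠ 0) (hc : c ≠ 0) (hd : d ≠ 0)
    (hab : a ≠ b) (hcd : c ≠ d) {n N : ℕ} (hN : 2 ≤ N) {S' T' : Set (GLn n)}
    (hS : ∀ B : Matrix (Fin n) (Fin n) ℂ, DiagWith {a, b} B → ∃ g ∈ S', g.val = B)
    (hT : ∀ C : Matrix (Fin n) (Fin n) ℂ, DiagWith {c, d} C → ∃ g ∈ T', g.val = C)
    (A : Matrix.SpecialLinearGroup (Fin n) ℂ) :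
    IsProdOfAtMost (commutators S' T') N (A : Matrix.GeneralLinearGroup (Fin n) ℂ) := by
  obtain ⟨X, Y, hXY, hX, hY⟩ := exists_mul_hasComm ha hb hc hd hab hcd A.det_coe
  obtain ⟨g, hg, rfl⟩ := hX.exists_mem_commutators hS hT
  obtain ⟨h, hh, rfl⟩ := hY.exists_mem_commutators hS hT
  refine ⟨[g, h], by simpa using hN, by simp [hg, hh], ?_⟩
  ext1
  simpa using hXY

end Products
end CommProd

theorem theorem1p5 (n : ℕ) (A : Matrix.SpecialLinearGroup (Fin n) ℂ) :
    CommProd.IsProdOfAtMost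
      (CommProd.commutators
        (CommProd.ofOrder n 2 ∩ CommProd.similarTo (CommProd.pmUT n 2))
        (CommProd.ofOrder n 2 ∩ CommProd.similarTo (CommProd.pmUT n 2)))
      2 (A : Matrix.GeneralLinearGroup (Fin n) ℂ) ∧
    CommProd.IsProdOfAtMost
      (CommProd.commutators
        (CommProd.ofSkewOrder n 2 ∩ CommProd.similarTo (CommProd.pmUT n 2))
        (CommProd.ofOrder n 2 ∩ CommProd.similarTo (CommProd.pmUT n 2)))
      2 (A : Matrix.GeneralLinearGroup (Fin n) ℂ) ∧
    (∀ k : ℕ, 2 ≤ k →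
      CommProd.IsProdOfAtMost
        (CommProd.commutators
          (CommProd.ofOrder n k ∩ CommProd.similarTo (CommProd.UT n k))
          (CommProd.ofOrder n k ∩ CommProd.similarTo (CommProd.UT n k)))
        (4 * k - 6) (A : Matrix.GeneralLinearGroup (Fin n) ℂ)) ∧
    (∀ k : ℕ, 1 ≤ k →
      CommProd.IsProdOfAtMost
        (CommProd.commutators
          (CommProd.ofSkewOrder n (2 * k) ∩ CommProd.similarTo (CommProd.pmUT n (2 * k)))
          (CommProd.ofOrder n (2 * k) ∩ CommProd.similarTo (CommProd.pmUT n (2 * k))))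
        (8 * k - 6) (A : Matrix.GeneralLinearGroup (Fin n) ℂ)) := by
  have hord : ∀ k, ∀ B : Matrix (Fin n) (Fin n) ℂ, CommProd.DiagWith {1, -1} B →
      ∃ g ∈ CommProd.ofOrder n (2 * k) ∩ CommProd.similarTo (CommProd.pmUT n (2 * k)),
        g.val = B := by
    intro k B hB
    obtain ⟨g, hg, rfl⟩ := hB.exists_mem_ofOrder (k := 2 * k) (by simp) (by
      rintro s (rfl | rfl) <;> simp [pow_mul])
    exact ⟨g, ⟨hg.1, CommProd.similarTo_mono (CommProd.UT_subset_pmUT n _) hg.2⟩, rfl⟩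
  have hone : (1 : ℂ) ≠ -1 := by norm_num
  have hskew : ∀ k, 1 ≤ k → CommProd.IsProdOfAtMost
      (CommProd.commutators
        (CommProd.ofSkewOrder n (2 * k) ∩ CommProd.similarTo (CommProd.pmUT n (2 * k)))
        (CommProd.ofOrder n (2 * k) ∩ CommProd.similarTo (CommProd.pmUT n (2 * k))))
      2 (A : Matrix.GeneralLinearGroup (Fin n) ℂ) := by
    intro k hk
    -- The eigenvalues `ζ` and `-ζ` of the skew factor, where `ζ ^ (2 * k) = -1`.
    obtain ⟨ζ, hζ⟩ := IsAlgClosed.exists_pow_nat_eq (-1 : ℂ) (n := 2 * k) (by omega)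
    have hζ0 : ζ ≠ 0 := by
      rintro rfl
      simp [show k ≠ 0 by omega] at hζ
    refine CommProd.isProdOfAtMost_commutators hζ0 (neg_ne_zero.mpr hζ0) one_ne_zero
      (neg_ne_zero.mpr one_ne_zero) (self_ne_neg.mpr hζ0) hone le_rfl (fun B hB => ?_) (hord k) A
    refine hB.exists_mem_ofSkewOrder (by simp [hζ0, eq_comm]) ?_
    rintro s (rfl | rfl)
    · exact hζ
    · rw [Even.neg_pow ⟨k, two_mul k⟩, hζ]
  refine ⟨?_, by simpa using hskew 1 le_rfl, fun k hk => ?_, fun k hk => ?_⟩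
  · exact CommProd.isProdOfAtMost_commutators one_ne_zero (neg_ne_zero.mpr one_ne_zero) one_ne_zero
      (neg_ne_zero.mpr one_ne_zero) hone hone le_rfl (hord 1) (hord 1) A
  · obtain ⟨ω, hω⟩ : ∃ ω : ℂ, IsPrimitiveRoot ω k :=
      ⟨_, Complex.isPrimitiveRoot_exp k (by omega)⟩
    have hω0 : ω ≠ 0 := hω.ne_zero (by omega)
    have hω1 : 1 ≠ ω := (hω.ne_one (by omega)).symm
    have hmem : ∀ B : Matrix (Fin n) (Fin n) ℂ, CommProd.DiagWith {1, ω} B →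
        ∃ g ∈ CommProd.ofOrder n k ∩ CommProd.similarTo (CommProd.UT n k), g.val = B := fun B hB =>
      hB.exists_mem_ofOrder (by simp [hω0.symm]) (by
        rintro s (rfl | rfl)
        · exact one_pow k
        · exact hω.pow_eq_one)
    exact CommProd.isProdOfAtMost_commutators one_ne_zero hω0 one_ne_zero hω0 hω1 hω1 (by omega)
      hmem hmem A
  · obtain ⟨l, hl, hl'⟩ := hskew k hk
    exact ⟨l, hl.trans (by omega), hl'⟩
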